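/- **Conventions.** All Lie algebras are real. A Lie algebra is *almost abelian* if it has an abelian ideal of codimension one. The notation $(\eta_1,\ldots,\eta_n)$ stands for the $n$-dimensional Lie algebra having a basis whose dual basis $f^1,\ldots,f^n$ satisfies $df^i=\eta_i$, where $d$ is the Chevalley–Eilenberg differential, $d\alpha(X,Y)=-\alpha([X,Y])$, and $f^{ij}$ (also written $f^{i,j}$) denotes $f^i\wedge f^j$; $n\mathbb{R}$ is the abelian Lie algebra $(0,\ldots,0)$. Let $\mathfrak g$ have dimension $4m$. A *hypercomplex structure* on $\mathfrak g$ is a triple $(I_1,I_2,I_3)$ of endomorphisms with $I_k^2=-\mathrm{Id}$, vanishing Nijenhuis tensors, and $I_1I_2I_3=-\mathrm{Id}$. Let $g$ be an inner product on $\mathfrak g$ that is Hermitian with respect to each $I_k$, and let $\omega_k=g(I_k\cdot,\cdot)$. Then $(I_1,I_2,I_3,g)$ is *hyperkähler* if $d\omega_k=0$ for $k=1,2,3$. It is *locally conformally hyperkähler* (LCHK) if there is a single $1$-form $\theta\in\mathfrak g^*$ (the common Lee form) with $d\theta=0$ and $d\omega_k=\frac{1}{2m-1}\,\theta\wedge\omega_k$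 for $k=1,2,3$. A *non-hyperkähler LCHK structure* is an LCHK structure that is not hyperkähler. **Proposition 5.2.** Let $\mathfrak g$ be a $4m$-dimensional almost abelian Lie algebra. 1. If $m=1$, $\mathfrak g$ admits a hyperkähler structure if and only if $\mathfrak g\cong 4\mathbb R$, and it admits a non-hyperkähler LCHK structure if and only if it is isomorphic to $(f^{14},f^{24},f^{34},0)$. 2. If $m=2$, $\mathfrak g$ admits a hyperkähler structure if and only if it is isomorphic to one of - $8\mathbb R$, - $(f^{28},-f^{18},f^{48},-f^{38},0,0,0,0)$, and it admits a non-hyperkähler LCHK structure if and only if it is isomorphic to one of - $(f^{18},f^{28},f^{38},f^{48},f^{58},f^{68},f^{78},0)$, - $(f^{18},f^{28},f^{38},f^{48}+pf^{58},-pf^{48}+f^{58},f^{68}+pf^{78},-pf^{68}+f^{78},0)$ for some real $p\neq0$. 3. If $m=3$, $\mathfrak g$ admits a hyperkähler structure if and only if it is isomorphic to one of - $12\mathbb R$, - $(f^{2,12},-f^{1,12},f^{4,12},-f^{3,12},0,0,0,0,0,0,0,0)$, - $(f^{2,12},-f^{1,12},f^{4,12},-f^{3,12},pf^{6,12},-pf^{5,12},pf^{8,12},-pf^{7,12},0,0,0,0)$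 for some real $p\neq0$, and it admits a non-hyperkähler LCHK structure if and only if it is isomorphic to one of - $(f^{1,12},f^{2,12},f^{3,12},f^{4,12},f^{5,12},f^{6,12},f^{7,12},f^{8,12},f^{9,12},f^{10,12},f^{11,12},0)$, - $(f^{1,12},f^{2,12},f^{3,12},f^{4,12},f^{5,12},f^{6,12},f^{7,12},f^{8,12}+pf^{9,12},-pf^{8,12}+f^{9,12},f^{10,12}+pf^{11,12},-pf^{10,12}+f^{11,12},0)$ for some real $p\neq0$, - $(f^{1,12},f^{2,12},f^{3,12},f^{4,12}+pf^{5,12},-pf^{4,12}+f^{5,12},f^{6,12}+pf^{7,12},-pf^{6,12}+f^{7,12},f^{8,12}+qf^{9,12},-qf^{8,12}+f^{9,12},f^{10,12}+qf^{11,12},-qf^{10,12}+f^{11,12},0)$ for some real $p,q$ with $pq\neq0$. -/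

import Mathlib

/-- A real Lie algebra is almost abelian if it has an abelian ideal of codimension one. -/
def IsAlmostAbelian (L : Type*) [LieRing L] [LieAlgebra ℝ L] : Prop :=
  ∃ n : LieIdeal ℝ L, IsLieAbelian n ∧ Module.finrank ℝ n + 1 = Module.finrank ℝ L

namespace LieForms

variable {L : Type*} [LieRing L] [LieAlgebra ℝ L]

/-- The wedge product `α ∧ β` of two `1`-forms: `(X, Y) ↦ α X * β Y - α Y * β X`. -/
def wedge (α β : Module.Dual ℝ L) : LinearMap.BilinForm ℝ L :=
  (LinearMap.mul ℝ ℝ).compl₁₂ α β - (LinearMap.mul ℝ ℝ).compl₁₂ β α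

theorem wedge_apply (α β : Module.Dual ℝ L) (X Y : L) :
    wedge α β X Y = α X * β Y - α Y * β X := by
  simp [wedge, mul_comm]

/-- The Chevalley–Eilenberg differential of a `1`-form: `dα (X, Y) = -α [X, Y]`. -/
def d₁ (α : Module.Dual ℝ L) : LinearMap.BilinForm ℝ L :=
  -((LieModule.toEnd ℝ L L : L →ₗ[ℝ] L →ₗ[ℝ] L).compr₂ α)

theorem d₁_apply (α : Module.Dual ℝ L) (X Y : L) : d₁ α X Y = -α ⁅X, Y⁆ := by
  simp [d₁]

/-- The Chevalley–Eilenberg differential of a `2`-form `ω`, evaluated on three vectors. -/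
def d₂ (ω : LinearMap.BilinForm ℝ L) (X Y Z : L) : ℝ :=
  -ω ⁅X, Y⁆ Z - ω ⁅Y, Z⁆ X - ω ⁅Z, X⁆ Y

/-- The wedge product `θ ∧ ω` of a `1`-form and a `2`-form, evaluated on three vectors. -/
def wedge₁₂ (θ : Module.Dual ℝ L) (ω : LinearMap.BilinForm ℝ L) (X Y Z : L) : ℝ :=
  θ X * ω Y Z + θ Y * ω Z X + θ Z * ω X Y

end LieForms

open LieForms

/-- `L` is isomorphic to the `n`-dimensional Lie algebra denoted by its structure equations
`(df¹, …, dfⁿ)`: there is a basis of `L` whose dual coframe `f¹, …, fⁿ` satisfies them. In `eqs`,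
the argument `f` stands for the `2`-forms `f i j = fⁱ ∧ fʲ`, and indices are counted from `0`. -/
def HasStructureEquations (L : Type*) [LieRing L] [LieAlgebra ℝ L] (n : ℕ)
    (eqs : (Fin n → Fin n → LinearMap.BilinForm ℝ L) → Fin n → LinearMap.BilinForm ℝ L) : Prop :=
  ∃ b : Module.Basis (Fin n) ℝ L,
    ∀ i, d₁ (b.coord i) = eqs (fun j k => wedge (b.coord j) (b.coord k)) i

section Structures

variable {L : Type*} [LieRing L] [LieAlgebra ℝ L]

/-- `J` is an (integrable) complex structure on the Lie algebra `L`: `J² = -1`, and the Nijenhuis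
tensor of `J` vanishes. -/
structure IsComplexStructure (J : L →ₗ[ℝ] L) : Prop where
  sq : ∀ X, J (J X) = -X
  integrable : ∀ X Y, ⁅J X, J Y⁆ - J ⁅J X, Y⁆ - J ⁅X, J Y⁆ - ⁅X, Y⁆ = 0

/-- `(I₁, I₂, I₃)` is a hypercomplex structure on `L`. -/
structure IsHypercomplex (I₁ I₂ I₃ : L →ₗ[ℝ] L) : Prop where
  fst : IsComplexStructure I₁
  snd : IsComplexStructure I₂
  trd : IsComplexStructure I₃
  mul : ∀ X, I₁ (I₂ (I₃ X)) = -X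

/-- `g` is a metric, i.e. a positive definite symmetric bilinear form on `L`. -/
structure IsMetric (g : LinearMap.BilinForm ℝ L) : Prop where
  symm : ∀ X Y, g X Y = g Y X
  pos : ∀ X, X ≠ 0 → 0 < g X X

/-- `(J, g)` is a Hermitian structure on `L`. -/
structure IsHermitianStructure (J : L →ₗ[ℝ] L) (g : LinearMap.BilinForm ℝ L) : Prop where
  complex : IsComplexStructure J
  metric : IsMetric g
  invariant : ∀ X Y, g (J X) (J Y) = g X Y

/-- The fundamental form `ω = g (J ·, ·)`. -/
def fundamentalForm (J : L →ₗ[ℝ] L) (g : LinearMap.BilinForm ℝ L) : LinearMap.BilinForm ℝ L :=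
  g.comp J LinearMap.id

/-- `(J, g)` is Kähler: it is Hermitian and `dω = 0`. -/
structure IsKahler (J : L →ₗ[ℝ] L) (g : LinearMap.BilinForm ℝ L) : Prop where
  hermitian : IsHermitianStructure J g
  closed : ∀ X Y Z, d₂ (fundamentalForm J g) X Y Z = 0

/-- `(J, g)` is locally conformally Kähler with Lee form `θ`: it is Hermitian, `dθ = 0` and
`dω = (n - 1)⁻¹ θ ∧ ω`, where `2n = dim L`. For `n ≥ 2` this determines `θ`, which
is then the `1`-form with `dω ^ (n - 1) = θ ∧ ω ^ (n - 1)`. -/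
structure IsLCKWithLeeForm (J : L →ₗ[ℝ] L) (g : LinearMap.BilinForm ℝ L)
    (θ : Module.Dual ℝ L) : Prop where
  hermitian : IsHermitianStructure J g
  lee_closed : d₁ θ = 0
  lee : ∀ X Y Z, d₂ (fundamentalForm J g) X Y Z =
    ((Module.finrank ℝ L : ℝ) / 2 - 1)⁻¹ * wedge₁₂ θ (fundamentalForm J g) X Y Z

/-- `(I₁, I₂, I₃, g)` is a hyperkähler structure on `L`. -/
structure IsHyperkahler (I₁ I₂ I₃ : L →ₗ[ℝ] L) (g : LinearMap.BilinForm ℝ L) : Prop where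
  hypercomplex : IsHypercomplex I₁ I₂ I₃
  fst : IsKahler I₁ g
  snd : IsKahler I₂ g
  trd : IsKahler I₃ g

/-- `(I₁, I₂, I₃, g)` is a locally conformally hyperkähler structure on `L`: `g` is locally
conformally Kähler with respect to `I₁`, `I₂`, `I₃`, and the three Lee forms coincide. -/
def IsLCHK (I₁ I₂ I₃ : L →ₗ[ℝ] L) (g : LinearMap.BilinForm ℝ L) : Prop :=
  IsHypercomplex I₁ I₂ I₃ ∧ ∃ θ : Module.Dual ℝ L,
    IsLCKWithLeeForm I₁ g θ ∧ IsLCKWithLeeForm I₂ g θ ∧ IsLCKWithLeeForm I₃ g θ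

end Structures

/-- `L` admits a hyperkähler structure. -/
def AdmitsHyperkahler (L : Type*) [LieRing L] [LieAlgebra ℝ L] : Prop :=
  ∃ (I₁ I₂ I₃ : L →ₗ[ℝ] L) (g : LinearMap.BilinForm ℝ L), IsHyperkahler I₁ I₂ I₃ g

/-- `L` admits a locally conformally hyperkähler structure that is not hyperkähler. -/
def AdmitsNonHyperkahlerLCHK (L : Type*) [LieRing L] [LieAlgebra ℝ L] : Prop :=
  ∃ (I₁ I₂ I₃ : L →ₗ[ℝ] L) (g : LinearMap.BilinForm ℝ L),
    IsLCHK I₁ I₂ I₃ g ∧ ¬ IsHyperkahler I₁ I₂ I₃ g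

/-! With `X` a unit normal to the abelian ideal, the whole bracket is encoded by `ad X`. The
hyperkähler and LCHK conditions both read dω = l ∧ ω for the three fundamental forms and one common
1-form `l`. Evaluated on suitable vectors, they force `l = -2c g(X, ·)` and, modulo `X`, `ad X = c +
B`, where `B` kills `X`, is skew and commutes with `I`, `J`, `K`
(`IsHyperHermitian.exists_normalBracket`). Conversely, every such `B` yields these structures, and
they are hyperkähler exactly when `c = 0` (`isHyperkahler`, `isLCHK`, `not_isHyperkahler`).

Since `I ∘ B` is symmetric, it can be diagonalised along orthogonal quaternionic lines, beginning
with the line of `X`, where its eigenvalue is 0. This gives `HasQuaternionicForm`: one rotation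
speed per line, with `μ 0 = 0`. Rescaling `X` multiplies `c` and all speeds by a common factor. For
LCHK this freedom normalises `c` to 1; for hyperkähler it normalises one nonzero speed to 1.
Permuting the lines then leaves the listed algebras. -/

/-- `I`, `J`, `K` satisfy the quaternion relations and are isometries of the metric `g`. -/
structure IsHyperHermitian {L : Type*} [LieRing L] [LieAlgebra ℝ L] (I J K : L →ₗ[ℝ] L)
    (g : LinearMap.BilinForm ℝ L) : Prop where
  metric : IsMetric g
  II : ∀ X, I (I X) = -X
  JJ : ∀ X, J (J X) = -X
  KK : ∀ X, K (K X) = -X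
  IJ : ∀ X, I (J X) = K X
  JK : ∀ X, J (K X) = I X
  KI : ∀ X, K (I X) = J X
  JI : ∀ X, J (I X) = -K X
  KJ : ∀ X, K (J X) = -I X
  IK : ∀ X, I (K X) = -J X
  gI : ∀ X Y, g (I X) (I Y) = g X Y
  gJ : ∀ X Y, g (J X) (J Y) = g X Y
  gK : ∀ X Y, g (K X) (K Y) = g X Y

/-! ### Normal form of the bracket -/

section

variable {L : Type*} [LieRing L] [LieAlgebra ℝ L] {I J K : L →ₗ[ℝ] L}
  {g : LinearMap.BilinForm ℝ L}

theorem IsHypercomplex.isHyperHermitian (h : IsHypercomplex I J K)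
    (hI : IsHermitianStructure I g) (hJ : IsHermitianStructure J g)
    (hK : IsHermitianStructure K g) : IsHyperHermitian I J K g := by
  have II := h.fst.sq
  have JJ := h.snd.sq
  have KK := h.trd.sq
  have IJ : ∀ X, I (J X) = K X := fun X => by
    have := h.mul (K X)
    rw [KK] at this
    simpa using this
  have JK : ∀ X, J (K X) = I X := fun X => by
    have := congrArg I (h.mul X)
    rw [II] at this
    simpa using this
  have JI : ∀ X, J (I X) = -K X := fun X => by
    rw [← JK, JJ]
  have KI : ∀ X, K (I X) = J X := fun X => by
    have := congrArg J (JK (I X))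
    rw [JJ, II, map_neg] at this
    simpa using this
  have IK : ∀ X, I (K X) = -J X := fun X => by
    rw [← IJ, II]
  have KJ : ∀ X, K (J X) = -I X := fun X => by
    rw [← IJ, JJ, map_neg]
  exact ⟨hI.metric, II, JJ, KK, IJ, JK, KI, JI, KJ, IK, hI.invariant, hJ.invariant, hK.invariant⟩

namespace IsHyperHermitian

theorem rotate (h : IsHyperHermitian I J K g) : IsHyperHermitian J K I g :=
  ⟨h.metric, h.JJ, h.KK, h.II, h.JK, h.KI, h.IJ, h.KJ, h.IK, h.JI, h.gJ, h.gK, h.gI⟩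

theorem apply_left (h : IsHyperHermitian I J K g) (X Y : L) : g (I X) Y = -g X (I Y) := by
  have := h.gI X (I Y)
  rw [h.II, map_neg] at this
  linarith

theorem apply_self (h : IsHyperHermitian I J K g) (X : L) : g (I X) X = 0 := by
  have h1 := h.apply_left X X
  have h2 := h.metric.symm X (I X)
  linarith

end IsHyperHermitian

/-- A unit normal `X` to the abelian ideal of codimension one determines the bracket through
`ad X`. -/
theorem IsAlmostAbelian.exists_unit_normal [FiniteDimensional ℝ L] (hL : IsAlmostAbelian L)
    (hg : IsMetric g) :
    ∃ X, g X X = 1 ∧ (∀ Y, g X ⁅X, Y⁆ = 0) ∧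
      ∀ Y Z, ⁅Y, Z⁆ = g X Y • ⁅X, Z⁆ - g X Z • ⁅X, Y⁆ := by
  obtain ⟨n, hn, hdim⟩ := hL
  let S : Submodule ℝ L := n.toSubmodule
  have hdim' : Module.finrank ℝ S + 1 = Module.finrank ℝ L := hdim
  let F : L →ₗ[ℝ] Module.Dual ℝ S := (Submodule.dualRestrict S).comp g
  -- The ideal has smaller dimension than `L`, so some nonzero vector is orthogonal to it.
  have hF : LinearMap.ker F ≠ ⊥ := by
    apply LinearMap.ker_ne_bot_of_finrank_lt
    rw [Subspace.dual_finrank_eq]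
    omega
  obtain ⟨X₀, hX₀, hX₀'⟩ := Submodule.exists_mem_ne_zero_of_ne_bot hF
  have hpos := hg.pos X₀ hX₀'
  have hs : 0 < √(g X₀ X₀) := Real.sqrt_pos.2 hpos
  obtain ⟨X, hXX, hXn⟩ : ∃ X, g X X = 1 ∧ ∀ Y ∈ S, g X Y = 0 := by
    refine ⟨(√(g X₀ X₀))⁻¹ • X₀, ?_, fun Y hY => ?_⟩
    · simp only [map_smul, LinearMap.smul_apply, smul_eq_mul]
      field_simp
      rw [Real.sq_sqrt hpos.le]
    · have : F X₀ ⟨Y, hY⟩ = 0 := by rw [LinearMap.mem_ker.1 hX₀]; rfl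
      have : g X₀ Y = 0 := this
      simp [this]
  have hne : g X ≠ 0 := fun h0 => by simp [h0] at hXX
  have hker : S = LinearMap.ker (g X) := by
    apply Submodule.eq_of_le_of_finrank_eq
    · intro Y hY
      exact hXn Y hY
    · have := Module.Dual.finrank_ker_add_one_of_ne_zero (f := g X) hne
      omega
  have hmem : ∀ Y, g X Y = 0 → Y ∈ n := fun Y hY => by
    have : Y ∈ S := by rw [hker]; exact hY
    exact this
  have hab : ∀ Y Z, g X Y = 0 → g X Z = 0 → ⁅Y, Z⁆ = 0 := fun Y Z hY hZ => by
    have := hn.trivial ⟨Y, hmem Y hY⟩ ⟨Z, hmem Z hZ⟩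
    simpa using congrArg (Subtype.val) this
  have hproj : ∀ Y, g X (Y - g X Y • X) = 0 := fun Y => by simp [hXX]
  refine ⟨X, hXX, fun Y => ?_, fun Y Z => ?_⟩
  · have h1 : ⁅X, Y - g X Y • X⁆ ∈ n := lie_mem_right ℝ L n _ _ (hmem _ (hproj Y))
    have h2 : ⁅X, Y - g X Y • X⁆ = ⁅X, Y⁆ := by simp
    rw [h2] at h1
    exact hXn _ h1
  · have h1 := hab _ _ (hproj Y) (hproj Z)
    have h2 : ⁅Y, X⁆ = -⁅X, Y⁆ := (lie_skew Y X).symm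
    simp only [lie_sub, sub_lie, lie_smul, smul_lie, lie_self, smul_zero, sub_zero, h2] at h1
    rw [smul_neg, sub_neg_eq_add] at h1
    rw [← sub_eq_zero, ← h1]; abel

/-- The bracket of `L` is `[Y, Z] = α(Y) T Z - α(Z) T Y`, where `α = g(X, ·)` for a unit vector `X`
and `T = c + B` with `B` skew-symmetric, quaternionic and `B X = 0`. -/
structure IsNormalBracket (I J K : L →ₗ[ℝ] L) (g : LinearMap.BilinForm ℝ L) (X : L) (c : ℝ)
    (B : L →ₗ[ℝ] L) : Prop where
  unit : g X X = 1
  map_normal : B X = 0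
  skew : ∀ Y Z, g (B Y) Z = -g Y (B Z)
  BI : ∀ Y, B (I Y) = I (B Y)
  BJ : ∀ Y, B (J Y) = J (B Y)
  BK : ∀ Y, B (K Y) = K (B Y)
  lie : ∀ Y Z, ⁅Y, Z⁆ = g X Y • (c • Z + B Z) - g X Z • (c • Y + B Y)

/-- If `dω = l ∧ ω` for the fundamental form `ω` of `I`, then `l` vanishes on the vectors orthogonal
to `X`, `J X` and `K X`. -/
theorem IsHyperHermitian.lee_apply_eq_zero (h : IsHyperHermitian I J K g) {X : L}
    {l : Module.Dual ℝ L} (hX : g X X = 1) (hlie : ∀ Y Z, ⁅Y, Z⁆ = g X Y • ⁅X, Z⁆ - g X Z • ⁅X, Y⁆)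
    (hd : ∀ Y Z W, d₂ (fundamentalForm I g) Y Z W = wedge₁₂ l (fundamentalForm I g) Y Z W)
    (Y : L) (h1 : g X Y = 0) (hJ : g (J X) Y = 0) (hK : g (K X) Y = 0) : l Y = 0 := by
  have hIX := h.apply_self X
  have hJX := h.rotate.apply_self X
  have hKX := h.rotate.rotate.apply_self X
  -- All three vectors lie in the abelian ideal, so the left side vanishes; on the right only `l Y`
  -- survives, with coefficient `g (I (J X)) (K X) = 1`.
  have e := hd Y (J X) (K X)
  have s1 := h.metric.symm X (J X)
  have s2 := h.metric.symm X (K X)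
  have s3 : g (I Y) (J X) = 0 := by rw [h.apply_left, h.IJ, h.metric.symm, hK, neg_zero]
  simp only [d₂, wedge₁₂, fundamentalForm, LinearMap.BilinForm.comp_apply, LinearMap.id_apply,
    hlie Y, hlie (J X), hlie (K X), h1, s1, s2, s3, hJX, hKX, h.IJ, h.IK, h.gK, hX] at e
  simpa [hJ] using e.symm

/-- Taking `Z = I X` in `key`, the second term vanishes because the image of `B` is orthogonal to
`X`. So `I (B (I X))` is orthogonal to the ideal, hence a multiple of `X`. -/
theorem IsHyperHermitian.map_apply_normal (h : IsHyperHermitian I J K g) {X : L} {B : L →ₗ[ℝ] L}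
    (hX : g X X = 1) (hB : ∀ Y, g X (B Y) = 0)
    (key : ∀ Z W, g X Z = 0 → g X W = 0 → g (I (B Z)) W + g (I Z) (B W) = 0) :
    B (I X) = g (I X) (B (I X)) • I X := by
  have hXI : g X (I X) = 0 := by rw [h.metric.symm]; exact h.apply_self X
  set V := I (B (I X)) with hV
  have hW : g X (V - g X V • X) = 0 := by simp [hX]
  have h1 := key (I X) _ hXI hW
  rw [h.II, map_neg, LinearMap.neg_apply, hB, ← hV] at h1
  have h2 : V - g X V • X = 0 := by
    by_contra hne
    have := h.metric.pos _ hne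
    simp only [map_sub, LinearMap.sub_apply, map_smul, LinearMap.smul_apply, smul_eq_mul] at *
    nlinarith
  have h3 : I V = -B (I X) := h.II _
  rw [sub_eq_zero.1 h2, map_smul] at h3
  have h4 : g X V = -g (I X) (B (I X)) := by rw [h.apply_left, neg_neg]
  rw [h4] at h3
  rw [← neg_inj, ← h3, neg_smul]

/-- Since `B X = 0`, extending `key` to the normal direction only requires `g (I X) (B Y) = 0`. This
comes from the condition for `J` at `K X`, because `J K = I` and `B (K X) = 0`. -/
theorem IsHyperHermitian.infinitesimal_invariance (h : IsHyperHermitian I J K g) {X : L}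
    {B : L →ₗ[ℝ] L} (hX : g X X = 1) (hBX : B X = 0) (hBK : B (K X) = 0)
    (key : ∀ Z W, g X Z = 0 → g X W = 0 → g (I (B Z)) W + g (I Z) (B W) = 0)
    (key' : ∀ Z W, g X Z = 0 → g X W = 0 → g (J (B Z)) W + g (J Z) (B W) = 0) (Z W : L) :
    g (I (B Z)) W + g (I Z) (B W) = 0 := by
  have hXK : g X (K X) = 0 := by rw [h.metric.symm]; exact h.rotate.rotate.apply_self X
  have hp : ∀ Y, g X (Y - g X Y • X) = 0 := fun Y => by simp [hX]
  have hBp : ∀ Y, B (Y - g X Y • X) = B Y := fun Y => by simp [hBX]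
  have h0 : ∀ Y, g (I X) (B Y) = 0 := fun Y => by
    have := key' (K X) _ hXK (hp Y)
    simpa [hBp, hBK, h.JK] using this
  have h1 : g (I (B Z)) X = 0 := by
    rw [h.apply_left, h.metric.symm, h0, neg_zero]
  have := key _ _ (hp Z) (hp W)
  simpa [hBp, h0, h1] using this

/-- `J` relates the two forms by `g (I (J Y)) Z = g (K Y) Z`; an operator infinitesimally preserving
both must commute with it. -/
theorem IsHyperHermitian.map_comm (h : IsHyperHermitian I J K g) {B : L →ₗ[ℝ] L}
    (hI : ∀ Z W, g (I (B Z)) W + g (I Z) (B W) = 0)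
    (hK : ∀ Z W, g (K (B Z)) W + g (K Z) (B W) = 0) (Y : L) : B (J Y) = J (B Y) := by
  by_contra hne
  have := h.metric.pos _ (sub_ne_zero.2 hne)
  rw [← h.gI] at this
  generalize hu : I (B (J Y) - J (B Y)) = u at this
  have e : g u u = g (I (B (J Y))) u - g (K (B Y)) u := by
    nth_rw 1 [← hu]
    simp [h.IJ]
  have h1 := hI (J Y) u
  have h2 := hK Y u
  rw [h.IJ] at h1
  linarith

theorem IsHyperHermitian.exists_normalBracket [FiniteDimensional ℝ L] (hL : IsAlmostAbelian L)
    (h : IsHyperHermitian I J K g) {l : Module.Dual ℝ L}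
    (hI : ∀ Y Z W, d₂ (fundamentalForm I g) Y Z W = wedge₁₂ l (fundamentalForm I g) Y Z W)
    (hJ : ∀ Y Z W, d₂ (fundamentalForm J g) Y Z W = wedge₁₂ l (fundamentalForm J g) Y Z W)
    (hK : ∀ Y Z W, d₂ (fundamentalForm K g) Y Z W = wedge₁₂ l (fundamentalForm K g) Y Z W) :
    ∃ X c B, IsNormalBracket I J K g X c B ∧ l = (-2 * c) • g X := by
  obtain ⟨X, hXX, hXn, hlie⟩ := hL.exists_unit_normal h.metric
  have sy := h.metric.symm
  have hIX := h.apply_self X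
  have hJX := h.rotate.apply_self X
  have hKX := h.rotate.rotate.apply_self X
  have hXI : g X (I X) = 0 := by rw [sy]; exact hIX
  have hXJ : g X (J X) = 0 := by rw [sy]; exact hJX
  have hXK : g X (K X) = 0 := by rw [sy]; exact hKX
  have lI : l (I X) = 0 := h.lee_apply_eq_zero hXX hlie hI _ hXI
    (by rw [h.rotate.apply_left, h.JI]; simp [hXK]) (by rw [h.rotate.rotate.apply_left, h.KI]; simp [hXJ])
  have lJ : l (J X) = 0 := h.rotate.lee_apply_eq_zero hXX hlie hJ _ hXJ
    (by rw [h.rotate.rotate.apply_left, h.KJ]; simp [hXI]) (by rw [h.apply_left, h.IJ]; simp [hXK])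
  have lK : l (K X) = 0 := h.rotate.rotate.lee_apply_eq_zero hXX hlie hK _ hXK
    (by rw [h.apply_left, h.IK]; simp [hXJ]) (by rw [h.rotate.apply_left, h.JK]; simp [hXI])
  have gJJ : g (J X) (J X) = 1 := by rw [h.gJ, hXX]
  have gKK : g (K X) (K X) = 1 := by rw [h.gK, hXX]
  have gII : g (I X) (I X) = 1 := by rw [h.gI, hXX]
  have gJK : g (J X) (K X) = 0 := by rw [h.rotate.apply_left, h.JK]; simp [hXI]
  have gKJ : g (K X) (J X) = 0 := by rw [sy, gJK]
  -- What remains of `Y` after removing its components along `X`, `J X`, `K X` is killed by `l`, and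
  -- so are `J X` and `K X`.
  have hl : l = l X • g X := by
    ext Y
    have := h.lee_apply_eq_zero hXX hlie hI
      (Y - g X Y • X - g (J X) Y • J X - g (K X) Y • K X)
      (by simp [hXX, hXJ, hXK]) (by simp [gJJ, gJK, hJX]) (by simp [gKK, gKJ, hKX])
    simp only [map_sub, map_smul, lJ, lK, smul_eq_mul] at this
    simp only [LinearMap.smul_apply, smul_eq_mul]
    linarith
  -- On the ideal, dω = l ∧ ω says `ω (T Z, W) + ω (Z, T W) = -l X * ω (Z, W)` for `T = ad X`;
  -- subtracting this `c` from `T` makes the right side zero.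
  set c : ℝ := -(l X) / 2 with hc
  have hlX : l X = -2 * c := by rw [hc]; ring
  -- The rank-one term compensates for `ad X` killing `X`, so that `B X = 0`.
  let B : L →ₗ[ℝ] L := (LieModule.toEnd ℝ L L X) + c • (g X).smulRight X - c • LinearMap.id
  have hB : ∀ Y, B Y = ⁅X, Y⁆ + (c * g X Y) • X - c • Y := fun Y => by
    simp [B, smul_smul]
  have hA : ∀ Y, ⁅X, Y⁆ = B Y - (c * g X Y) • X + c • Y := fun Y => by
    rw [hB]; abel
  have hBX : B X = 0 := by rw [hB]; simp [hXX]
  have hgB : ∀ Y, g X (B Y) = 0 := fun Y => by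
    rw [hB]; simp [hXX, hXn]
  have hlie' : ∀ Y Z, ⁅Y, Z⁆ = g X Y • (c • Z + B Z) - g X Z • (c • Y + B Y) := fun Y Z => by
    rw [hlie, hA, hA]; module
  have key : ∀ (R : L →ₗ[ℝ] L),
      (∀ Y Z W, d₂ (fundamentalForm R g) Y Z W = wedge₁₂ l (fundamentalForm R g) Y Z W) →
      (∀ Y Z, g (R Y) Z = - g Y (R Z)) →
      ∀ Z W, g X Z = 0 → g X W = 0 → g (R (B Z)) W + g (R Z) (B W) = 0 := by
    intro R hR hs Z W hZ hW
    have e := hR X Z W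
    have lZ : l Z = 0 := by rw [hl]; simp [hZ]
    have lW : l W = 0 := by rw [hl]; simp [hW]
    simp only [d₂, wedge₁₂, fundamentalForm, LinearMap.BilinForm.comp_apply, LinearMap.id_apply,
      hlie', hZ, hW, hXX, lZ, lW, hBX, hlX] at e
    simp at e
    have e1 := hs W Z
    have e2 := sy W (R Z)
    have e3 := hs (B W) Z
    have e4 := sy (B W) (R Z)
    linear_combination -e + c * (e1 - e2) + (e3 - e4)
  have kI := key I hI h.apply_left
  have kJ := key J hJ h.rotate.apply_left
  have kK := key K hK h.rotate.rotate.apply_left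
  have tI := h.map_apply_normal hXX hgB kI
  have tJ := h.rotate.map_apply_normal hXX hgB kJ
  have tK := h.rotate.rotate.map_apply_normal hXX hgB kK
  set a := g (I X) (B (I X))
  set b := g (J X) (B (J X))
  set d := g (K X) (B (K X))
  -- `B` scales `I X`, `J X`, `K X` by `a`, `b`, `d`. Invariance makes each pairwise sum zero, so
  -- all three vanish.
  have e1 : b + d = 0 := by
    have := kI (J X) (K X) hXJ hXK
    rw [tJ, tK, map_smul, map_smul, h.IJ] at this
    simpa [gKK] using this
  have e2 : d + a = 0 := by
    have := kJ (K X) (I X) hXK hXI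
    rw [tI, tK, map_smul, map_smul, h.JK] at this
    simpa [gII] using this
  have e3 : a + b = 0 := by
    have := kK (I X) (J X) hXI hXJ
    rw [tI, tJ, map_smul, map_smul, h.KI] at this
    simpa [gJJ] using this
  rw [show a = 0 by linarith, zero_smul] at tI
  rw [show b = 0 by linarith, zero_smul] at tJ
  rw [show d = 0 by linarith, zero_smul] at tK
  have fI := h.infinitesimal_invariance hXX hBX tK kI kJ
  have fJ := h.rotate.infinitesimal_invariance hXX hBX tI kJ kK
  have fK := h.rotate.rotate.infinitesimal_invariance hXX hBX tJ kK kI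
  have BI := h.rotate.rotate.map_comm fK fJ
  refine ⟨X, c, B, ⟨hXX, hBX, fun Y Z => ?_, BI, h.map_comm fI fK, h.rotate.map_comm fJ fI, hlie'⟩,
    by rw [← hlX]; exact hl⟩
  have := fI (I Y) Z
  rw [BI, h.II, h.II] at this
  simp only [map_neg, LinearMap.neg_apply] at this
  linarith
end

/-! ### Diagonalisation along quaternionic lines -/

section

variable {L : Type*} [LieRing L] [LieAlgebra ℝ L] {I J K : L →ₗ[ℝ] L}
  {g : LinearMap.BilinForm ℝ L}

/-- A symmetric operator has a unit eigenvector in every nonzero invariant subspace. -/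
theorem IsMetric.exists_unit_eigenvector [FiniteDimensional ℝ L] (hg : IsMetric g)
    {T : L →ₗ[ℝ] L} (hT : ∀ Y Z, g (T Y) Z = g Y (T Z)) {W : Submodule ℝ L} (hW : W ≠ ⊥)
    (hTW : ∀ Y ∈ W, T Y ∈ W) : ∃ w ∈ W, g w w = 1 ∧ ∃ a : ℝ, T w = a • w := by
  -- `g` makes `W` a Euclidean space, so the spectral theorem for symmetric operators applies.
  let core : InnerProductSpace.Core ℝ W :=
    { inner := fun x y => g x y
      conj_inner_symm := fun x y => hg.symm _ _
      re_inner_nonneg := fun x => by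
        by_cases hx : (x : L) = 0
        · simp [hx]
        · exact (hg.pos _ hx).le
      add_left := fun x y z => by simp
      smul_left := fun x y r => by simp
      definite := fun x hx => by
        by_contra hne
        exact (hg.pos x (by simpa using hne)).ne' hx }
  let _ : NormedAddCommGroup W := core.toNormedAddCommGroup
  let _ : InnerProductSpace ℝ W := InnerProductSpace.ofCore core.toCore
  have _ : Nontrivial W := Submodule.nontrivial_iff_ne_bot.2 hW
  have hsym : (T.restrict hTW).IsSymmetric := fun x y => hT x y
  obtain ⟨a, ha⟩ : ∃ a : ℝ, Module.End.HasEigenvalue (T.restrict hTW) a :=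
    ⟨_, hsym.hasEigenvalue_iSup_of_finiteDimensional⟩
  obtain ⟨w, hw⟩ := ha.exists_hasEigenvector
  have hw1 : T w = a • (w : L) := congrArg Subtype.val hw.apply_eq_smul
  have hw0 : (w : L) ≠ 0 := by simpa using hw.2
  have hpos := hg.pos _ hw0
  have hs : 0 < √(g w w) := Real.sqrt_pos.2 hpos
  refine ⟨(√(g w w))⁻¹ • (w : L), W.smul_mem _ w.2, ?_, a, ?_⟩
  · simp only [map_smul, LinearMap.smul_apply, smul_eq_mul]
    field_simp
    rw [Real.sq_sqrt hpos.le]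
  · rw [map_smul, hw1, smul_comm]

/-- Left multiplication by the quaternions `1, i, k, j`. -/
def quat (I J K : L →ₗ[ℝ] L) : Fin 4 → L →ₗ[ℝ] L := ![LinearMap.id, I, K, J]

namespace IsHyperHermitian

theorem quat_orthogonal (h : IsHyperHermitian I J K g) {u w : L}
    (huw : ∀ a, g (quat I J K a u) w = 0) (a b : Fin 4) :
    g (quat I J K a u) (quat I J K b w) = 0 := by
  have e0 : g u w = 0 := huw 0
  have e1 : g (I u) w = 0 := huw 1
  have e2 : g (K u) w = 0 := huw 2
  have e3 : g (J u) w = 0 := huw 3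
  have f1 : g u (I w) = 0 := by rw [← neg_inj, ← h.apply_left, e1, neg_zero]
  have f2 : g u (K w) = 0 := by rw [← neg_inj, ← h.rotate.rotate.apply_left, e2, neg_zero]
  have f3 : g u (J w) = 0 := by rw [← neg_inj, ← h.rotate.apply_left, e3, neg_zero]
  fin_cases a <;> fin_cases b <;>
    simp [quat, h.apply_left, h.rotate.apply_left, h.rotate.rotate.apply_left, h.II, h.JJ, h.KK,
      h.IJ, h.JK, h.KI, h.JI, h.KJ, h.IK, e0, f1, f2, f3]

theorem quat_orthonormal (h : IsHyperHermitian I J K g) {u : L} (hu : g u u = 1) (a b : Fin 4) :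
    g (quat I J K a u) (quat I J K b u) = if a = b then 1 else 0 := by
  have e1 := h.apply_self u
  have e2 := h.rotate.rotate.apply_self u
  have e3 := h.rotate.apply_self u
  have f1 := h.metric.symm u (I u)
  have f2 := h.metric.symm u (K u)
  have f3 := h.metric.symm u (J u)
  rw [e1] at f1
  rw [e2] at f2
  rw [e3] at f3
  fin_cases a <;> fin_cases b <;>
    simp [quat, h.apply_left, h.rotate.apply_left, h.rotate.rotate.apply_left, h.II, h.JJ, h.KK,
      h.IJ, h.JK, h.KI, h.JI, h.KJ, h.IK, hu, f1, f2, f3]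

/-- Extending an orthonormal family of eigenvectors of a quaternionic skew-symmetric operator. -/
theorem exists_eigenfamily [FiniteDimensional ℝ L] (h : IsHyperHermitian I J K g)
    {X : L} {c : ℝ} {B : L →ₗ[ℝ] L} (hB : IsNormalBracket I J K g X c B) {r : ℕ}
    (hr : Module.finrank ℝ L = 4 * (r + 1)) (n : ℕ) (hn : n ≤ r) :
    ∃ (v : Fin (n + 1) → L) (μ : Fin (n + 1) → ℝ), v 0 = X ∧ μ 0 = 0 ∧
      (∀ i, I (B (v i)) = μ i • v i) ∧ (∀ i, g (v i) (v i) = 1) ∧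
      ∀ i j, i < j → ∀ a, g (quat I J K a (v i)) (v j) = 0 := by
  induction n with
  | zero =>
    refine ⟨fun _ => X, fun _ => 0, rfl, rfl, by simp [hB.map_normal], fun _ => hB.unit, ?_⟩
    intro i j hij
    exact absurd hij (by omega)
  | succ n ih =>
    obtain ⟨v, μ, hv0, hμ0, hv, hv1, hvo⟩ := ih (by omega)
    let F : L →ₗ[ℝ] (Fin (n + 1) × Fin 4 → ℝ) :=
      LinearMap.pi fun p => g (quat I J K p.2 (v p.1))
    -- The kernel is the orthogonal complement of the lines found so far. It is nonzero because `4 *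
    -- (n + 1) < 4 * (r + 1)`.
    have hF : LinearMap.ker F ≠ ⊥ := by
      apply LinearMap.ker_ne_bot_of_finrank_lt
      rw [hr]
      simp
      omega
    have hmem : ∀ w, w ∈ LinearMap.ker F ↔ ∀ i a, g (quat I J K a (v i)) w = 0 := fun w => by
      rw [LinearMap.mem_ker, funext_iff]
      exact ⟨fun H i a => H (i, a), fun H p => H p.1 p.2⟩
    -- `I ∘ B` is symmetric as a product of commuting skew operators. It preserves the complement
    -- because `B (v i) = -μ i • I (v i)` stays in the line of `v i`.
    obtain ⟨w, hw, hww, a, haw⟩ := h.metric.exists_unit_eigenvector (T := I ∘ₗ B)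
      (fun Y Z => by
        rw [LinearMap.comp_apply, LinearMap.comp_apply, h.apply_left, hB.skew, neg_neg, hB.BI]) hF
      (fun w hw => by
        rw [hmem] at hw ⊢
        intro i b
        have h1 := h.quat_orthogonal (hw i) b 1
        have hq : B (quat I J K b (v i)) = quat I J K b (B (v i)) := by
          fin_cases b <;> simp [quat, hB.BI, hB.BJ, hB.BK]
        have hBv : B (v i) = -(μ i • I (v i)) := by
          rw [← map_smul, ← hv, h.II, neg_neg]
        rw [LinearMap.comp_apply, ← hB.BI, ← neg_inj, ← hB.skew, hq, hBv]
        have h2 := h.quat_orthogonal (u := I (v i)) (w := w) (fun c => by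
          have e0 : g (v i) w = 0 := hw i 0
          have e1 : g (I (v i)) w = 0 := hw i 1
          have e2 : g (K (v i)) w = 0 := hw i 2
          have e3 : g (J (v i)) w = 0 := hw i 3
          fin_cases c <;> simp [quat, h.II, h.JI, h.KI, e0, e1, e2, e3]) b 1
        simp only [map_neg, map_smul, LinearMap.neg_apply, LinearMap.smul_apply]
        have h3 : g (quat I J K b (I (v i))) (I w) = 0 := h2
        rw [h3]; simp)
    rw [hmem] at hw
    refine ⟨Fin.snoc (α := fun _ => L) v w, Fin.snoc (α := fun _ => ℝ) μ a, ?_, ?_, ?_, ?_, ?_⟩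
    · rw [← hv0]; exact Fin.snoc_castSucc (α := fun _ => L) w v 0
    · rw [← hμ0]; exact Fin.snoc_castSucc (α := fun _ => ℝ) a μ 0
    · intro i
      refine Fin.lastCases ?_ (fun i => ?_) i
      · simpa using haw
      · simpa using hv i
    · intro i
      refine Fin.lastCases ?_ (fun i => ?_) i
      · simpa using hww
      · simpa using hv1 i
    · intro i j
      refine Fin.lastCases ?_ (fun j => ?_) j
      · refine Fin.lastCases ?_ (fun i => ?_) i
        · simp
        · intro _ b
          simpa using hw i b
      · refine Fin.lastCases ?_ (fun i => ?_) i
        · intro hij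
          exact absurd hij (by simpa using (Fin.castSucc_lt_last j).le)
        · intro hij b
          simpa using hvo i j (by simpa using hij) b

end IsHyperHermitian

/-- The involution of the coordinates of a quaternionic line that pairs those rotated into each
other. -/
def partner : Fin 4 → Fin 4 := ![1, 0, 3, 2]

/-- The signs of the off-diagonal structure constants. -/
def rotSign : Fin 4 → ℝ := ![1, -1, 1, -1]

/-- `L` has a basis indexed by `m` quaternionic lines with structure equations given by a
multiple of the identity plus a rotation with speed `μ j` on the `j`-th line. -/
def HasQuaternionicForm (L : Type*) [LieRing L] [LieAlgebra ℝ L] (r : ℕ) (c : ℝ)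
    (μ : Fin (r + 1) → ℝ) : Prop :=
  ∃ b : Module.Basis (Fin (r + 1) × Fin 4) ℝ L, ∀ p,
    d₁ (b.coord p) = c • wedge (b.coord p) (b.coord (0, 0)) +
      (μ p.1 * rotSign p.2) • wedge (b.coord (p.1, partner p.2)) (b.coord (0, 0))

/-- Passing to the dual basis transposes the matrix of `B`, so the sign is that of the coordinate
itself, not of its partner. -/
theorem coord_rotation {r : ℕ} {μ : Fin (r + 1) → ℝ}
    (b : Module.Basis (Fin (r + 1) × Fin 4) ℝ L) {B : L →ₗ[ℝ] L}
    (hB : ∀ j a, B (b (j, a)) = (μ j * rotSign (partner a)) • b (j, partner a))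
    (p : Fin (r + 1) × Fin 4) (Y : L) :
    b.coord p (B Y) = (μ p.1 * rotSign p.2) * b.coord (p.1, partner p.2) Y := by
  obtain ⟨i, a⟩ := p
  suffices H : (b.coord (i, a)) ∘ₗ B = (μ i * rotSign a) • b.coord (i, partner a) from
    congrArg (fun f => f Y) H
  refine b.ext fun ⟨j, a'⟩ => ?_
  rw [LinearMap.comp_apply, hB, LinearMap.smul_apply]
  simp only [map_smul, Module.Basis.coord_apply, Module.Basis.repr_self, Finsupp.single_apply]
  by_cases hij : j = i
  · subst hij
    fin_cases a <;> fin_cases a' <;> simp [partner, rotSign]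
  · simp [hij]

theorem IsNormalBracket.hasQuaternionicForm [FiniteDimensional ℝ L] (h : IsHyperHermitian I J K g)
    {X : L} {c : ℝ} {B : L →ₗ[ℝ] L} (hB : IsNormalBracket I J K g X c B) {r : ℕ}
    (hr : Module.finrank ℝ L = 4 * (r + 1)) :
    ∃ μ : Fin (r + 1) → ℝ, μ 0 = 0 ∧ HasQuaternionicForm L r c μ := by
  obtain ⟨v, μ, hv0, hμ0, hv, hv1, hvo⟩ := h.exists_eigenfamily hB hr r le_rfl
  refine ⟨μ, hμ0, ?_⟩
  let e : Fin (r + 1) × Fin 4 → L := fun p => quat I J K p.2 (v p.1)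
  have he : ∀ p q, g (e p) (e q) = if p = q then 1 else 0 := by
    rintro ⟨i, a⟩ ⟨j, b⟩
    rcases lt_trichotomy i j with hij | rfl | hij
    · simpa [hij.ne] using h.quat_orthogonal (hvo i j hij) a b
    · simpa using h.quat_orthonormal (hv1 i) a b
    · rw [h.metric.symm]
      simpa [hij.ne'] using h.quat_orthogonal (hvo j i hij) b a
  have hli : LinearIndependent ℝ e := by
    apply LinearMap.linearIndependent_of_isOrthoᵢ (B := g)
    · intro p q hpq
      have := he p q
      rwa [if_neg hpq] at this
    · intro p
      simp [he]
  let b : Module.Basis (Fin (r + 1) × Fin 4) ℝ L :=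
    basisOfLinearIndependentOfCardEqFinrank hli (by rw [hr]; simp; ring)
  have hb : ∀ p, b p = e p := fun p => by simp [b]
  have hα : b.coord (0, 0) = g X := by
    refine b.ext fun p => ?_
    have h0 : e (0, 0) = X := hv0
    rw [hb, ← h0, he, ← hb, Module.Basis.coord_apply, Module.Basis.repr_self, Finsupp.single_apply]
    simp [eq_comm]
  have hBc := coord_rotation (μ := μ) b (B := B) fun j a => by
    have hBv : B (v j) = -(μ j • I (v j)) := by
      rw [← map_smul, ← hv, h.II, neg_neg]
    rw [hb, hb]
    -- In the order `1, i, k, j` both planes of a line rotate with the same sign; the order `1, i,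
    -- j, k` would reverse the second.
    fin_cases a <;>
      simp [e, quat, partner, rotSign, hB.BI, hB.BJ, hB.BK, hBv, h.II, h.JI, h.KI]
  refine ⟨b, fun p => ?_⟩
  ext Y Z
  rw [d₁_apply, hB.lie, ← hα]
  simp only [map_sub, map_add, map_smul, hBc, LinearMap.add_apply, LinearMap.smul_apply,
    wedge_apply, smul_eq_mul]
  ring
end

/-! ### Structures from a normal bracket, and the model -/

section

variable {L : Type*} [LieRing L] [LieAlgebra ℝ L] {I J K : L →ₗ[ℝ] L}
  {g : LinearMap.BilinForm ℝ L} {X : L} {c : ℝ} {B : L →ₗ[ℝ] L}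

namespace IsNormalBracket

theorem rotate (hB : IsNormalBracket I J K g X c B) : IsNormalBracket J K I g X c B :=
  ⟨hB.unit, hB.map_normal, hB.skew, hB.BJ, hB.BK, hB.BI, hB.lie⟩

/-- The Nijenhuis tensor cancels because `c + B` commutes with `I`. -/
theorem isHermitianStructure (h : IsHyperHermitian I J K g) (hB : IsNormalBracket I J K g X c B) :
    IsHermitianStructure I g := by
  refine ⟨⟨h.II, fun Y Z => ?_⟩, h.metric, h.gI⟩
  simp only [hB.lie, map_sub, map_add, map_smul, hB.BI, h.II]
  module

/-- `g (I (B ·)) ·` is symmetric, so the contribution of `B` cancels and only the scalar part of the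
bracket is seen. -/
theorem d₂_fundamentalForm (h : IsHyperHermitian I J K g) (hB : IsNormalBracket I J K g X c B)
    (Y Z W : L) : d₂ (fundamentalForm I g) Y Z W =
      -2 * c * wedge₁₂ (g X) (fundamentalForm I g) Y Z W := by
  have key : ∀ Y Z, g (I (B Y)) Z = g (I (B Z)) Y := fun Y Z => by
    rw [← hB.BI, hB.skew, h.apply_left, neg_neg, h.metric.symm]
  have anti : ∀ Y Z, g (I Y) Z = -g (I Z) Y := fun Y Z => by
    rw [h.apply_left, h.metric.symm]
  simp only [d₂, wedge₁₂, fundamentalForm, LinearMap.BilinForm.comp_apply, LinearMap.id_apply,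
    hB.lie, map_sub, map_add, map_smul, LinearMap.sub_apply, LinearMap.add_apply,
    LinearMap.smul_apply, smul_eq_mul]
  linear_combination g X Z * key Y W - g X Y * key Z W - g X W * key Y Z +
    c * g X Y * anti Z W + c * g X Z * anti W Y + c * g X W * anti Y Z

theorem isHypercomplex (h : IsHyperHermitian I J K g) (hB : IsNormalBracket I J K g X c B) :
    IsHypercomplex I J K :=
  ⟨(hB.isHermitianStructure h).complex, (hB.rotate.isHermitianStructure h.rotate).complex,
    (hB.rotate.rotate.isHermitianStructure h.rotate.rotate).complex,
    fun Y => by rw [h.JK, h.II]⟩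

theorem isKahler (h : IsHyperHermitian I J K g) (hB : IsNormalBracket I J K g X 0 B) :
    IsKahler I g :=
  ⟨hB.isHermitianStructure h, fun Y Z W => by rw [hB.d₂_fundamentalForm h]; ring⟩

theorem isHyperkahler (h : IsHyperHermitian I J K g) (hB : IsNormalBracket I J K g X 0 B) :
    IsHyperkahler I J K g :=
  ⟨hB.isHypercomplex h, hB.isKahler h, hB.rotate.isKahler h.rotate,
    hB.rotate.rotate.isKahler h.rotate.rotate⟩

theorem isLCKWithLeeForm (h : IsHyperHermitian I J K g) (hB : IsNormalBracket I J K g X c B)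
    (hd : (Module.finrank ℝ L : ℝ) / 2 - 1 ≠ 0) :
    IsLCKWithLeeForm I g ((((Module.finrank ℝ L : ℝ) / 2 - 1) * (-2 * c)) • g X) := by
  -- The Lee form is closed since brackets have no `X` component; its factor cancels the
  -- normalisation in the LCK equation.
  refine ⟨hB.isHermitianStructure h, ?_, fun Y Z W => ?_⟩
  · ext Y Z
    have hX : ∀ Y, g X (B Y) = 0 := fun Y => by
      rw [← neg_inj, ← hB.skew, hB.map_normal]; simp
    rw [d₁_apply, hB.lie]
    simp only [map_sub, map_add, map_smul, LinearMap.smul_apply, smul_eq_mul, hX,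
      LinearMap.zero_apply]
    ring
  · rw [hB.d₂_fundamentalForm h]
    simp only [wedge₁₂, LinearMap.smul_apply, smul_eq_mul]
    generalize (Module.finrank ℝ L : ℝ) / 2 - 1 = k at hd
    field_simp
    ring

theorem isLCHK (h : IsHyperHermitian I J K g) (hB : IsNormalBracket I J K g X c B)
    (hd : (Module.finrank ℝ L : ℝ) / 2 - 1 ≠ 0) : IsLCHK I J K g :=
  ⟨hB.isHypercomplex h, _, hB.isLCKWithLeeForm h hd, hB.rotate.isLCKWithLeeForm h.rotate hd,
    hB.rotate.rotate.isLCKWithLeeForm h.rotate.rotate hd⟩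

theorem not_isHyperkahler (h : IsHyperHermitian I J K g) (hB : IsNormalBracket I J K g X c B)
    (hc : c ≠ 0) : ¬ IsHyperkahler I J K g := by
  intro hK
  -- On these vectors dω equals `-2 * c`.
  have e := hK.fst.closed X (J X) (K X)
  have e1 : g X (J X) = 0 := by rw [h.metric.symm]; exact h.rotate.apply_self X
  have e2 : g X (K X) = 0 := by rw [h.metric.symm]; exact h.rotate.rotate.apply_self X
  rw [hB.d₂_fundamentalForm h] at e
  simp [wedge₁₂, fundamentalForm, h.IJ, h.gK, hB.unit, e1, e2, hc] at e

end IsNormalBracket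

section Model

variable {r : ℕ} (b : Module.Basis (Fin (r + 1) × Fin 4) ℝ L)

/-- The metric for which the basis `b` is orthonormal. -/
noncomputable def basisMetric : LinearMap.BilinForm ℝ L :=
  ∑ p, (LinearMap.mul ℝ ℝ).compl₁₂ (b.coord p) (b.coord p)

theorem basisMetric_apply (Y Z : L) :
    basisMetric b Y Z = ∑ p, b.coord p Y * b.coord p Z := by
  simp [basisMetric, LinearMap.sum_apply]

theorem basisMetric_basis (p q : Fin (r + 1) × Fin 4) :
    basisMetric b (b p) (b q) = if p = q then 1 else 0 := by
  simp [basisMetric_apply, Finsupp.single_apply]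

theorem basisMetric_left (p : Fin (r + 1) × Fin 4) : basisMetric b (b p) = b.coord p :=
  b.ext fun q => by simp [basisMetric_basis, Finsupp.single_apply, eq_comm]

theorem isMetric_basisMetric : IsMetric (basisMetric b) := by
  refine ⟨fun Y Z => by simp only [basisMetric_apply, mul_comm], fun Y hY => ?_⟩
  rw [basisMetric_apply]
  obtain ⟨p, hp⟩ : ∃ p, b.coord p Y ≠ 0 := by
    by_contra! H
    exact hY ((b.forall_coord_eq_zero_iff).1 H)
  exact Finset.sum_pos' (fun q _ => mul_self_nonneg _)
    ⟨p, Finset.mem_univ _, mul_self_pos.2 hp⟩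

/-- The map permuting the basis vectors of each quaternionic line, up to signs. -/
noncomputable def signedPerm (π : Fin 4 → Fin 4) (ε : Fin 4 → ℝ) : L →ₗ[ℝ] L :=
  b.constr ℝ fun p => ε p.2 • b (p.1, π p.2)

theorem signedPerm_basis (π : Fin 4 → Fin 4) (ε : Fin 4 → ℝ) (j : Fin (r + 1)) (a : Fin 4) :
    signedPerm b π ε (b (j, a)) = ε a • b (j, π a) := by
  simp [signedPerm]

theorem signedPerm_comp {π π' : Fin 4 → Fin 4} {ε ε' : Fin 4 → ℝ} {T : L →ₗ[ℝ] L}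
    (hT : ∀ j a, T (b (j, a)) = (ε' a * ε (π' a)) • b (j, π (π' a))) (Y : L) :
    signedPerm b π ε (signedPerm b π' ε' Y) = T Y := by
  suffices H : signedPerm b π ε ∘ₗ signedPerm b π' ε' = T from congrArg (fun f => f Y) H
  refine b.ext fun ⟨j, a⟩ => ?_
  simp [signedPerm_basis, hT, smul_smul]

theorem signedPerm_isometry {π : Fin 4 → Fin 4} {ε : Fin 4 → ℝ} (hπ : Function.Injective π)
    (hε : ∀ a, ε a * ε a = 1) (Y Z : L) :
    basisMetric b (signedPerm b π ε Y) (signedPerm b π ε Z) = basisMetric b Y Z := by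
  suffices H : (basisMetric b).compl₁₂ (signedPerm b π ε) (signedPerm b π ε) = basisMetric b from
    congrArg (fun f => f Y Z) H
  refine LinearMap.BilinForm.ext_basis b fun ⟨j, a⟩ ⟨j', a'⟩ => ?_
  by_cases hj : (j, a) = (j', a')
  · obtain ⟨rfl, rfl⟩ := Prod.mk.inj hj
    simp [signedPerm_basis, basisMetric_basis, hε]
  · have : (j, π a) ≠ (j', π a') := fun H => hj (by
      obtain ⟨h1, h2⟩ := Prod.mk.inj H
      rw [h1, hπ h2])
    simp only [LinearMap.compl₁₂_apply, signedPerm_basis, map_smul, LinearMap.smul_apply,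
      basisMetric_basis, if_neg this, if_neg hj, smul_zero]

/-- The tables are left multiplication by `i`, `j`, `k` on the ordered basis `1, i, k, j` of each
line. -/
theorem isHyperHermitian_signedPerm : IsHyperHermitian
    (signedPerm b ![1, 0, 3, 2] ![1, -1, -1, 1]) (signedPerm b ![3, 2, 1, 0] ![1, -1, 1, -1])
    (signedPerm b ![2, 3, 0, 1] ![1, 1, -1, -1]) (basisMetric b) := by
  refine ⟨isMetric_basisMetric b, fun Y => ?_, fun Y => ?_, fun Y => ?_, ?_, ?_, ?_, fun Y => ?_,
    fun Y => ?_, fun Y => ?_, ?_, ?_, ?_⟩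
  iterate 3
    rw [← LinearMap.id_apply (R := ℝ) Y, ← LinearMap.neg_apply]
    apply signedPerm_comp
    intro j a
    fin_cases a <;> simp
  iterate 3
    apply signedPerm_comp
    intro j a
    rw [signedPerm_basis]
    fin_cases a <;> simp
  iterate 3
    rw [← LinearMap.neg_apply]
    apply signedPerm_comp
    intro j a
    rw [LinearMap.neg_apply, signedPerm_basis]
    fin_cases a <;> simp
  iterate 3
    apply signedPerm_isometry
    · decide
    · intro a
      fin_cases a <;> simp

end Model
end

/-! ### Normalisation and coordinate-free criteria -/

section

variable {L : Type*} [LieRing L] [LieAlgebra ℝ L] {r : ℕ} {c : ℝ} {μ : Fin (r + 1) → ℝ}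

namespace HasQuaternionicForm

/-- On the `j`-th line `B` is right multiplication by `-μ j` times the unit `i`, so it commutes with
all left multiplications. -/
theorem exists_normalBracket (hμ : μ 0 = 0) (H : HasQuaternionicForm L r c μ) :
    ∃ I J K g X B, IsHyperHermitian (L := L) I J K g ∧ IsNormalBracket I J K g X c B := by
  obtain ⟨b, hb⟩ := H
  let B : L →ₗ[ℝ] L :=
    b.constr ℝ fun p => (μ p.1 * rotSign (partner p.2)) • b (p.1, partner p.2)
  have hB : ∀ j a, B (b (j, a)) = (μ j * rotSign (partner a)) • b (j, partner a) := fun j a => by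
    simp [B]
  have hBc := coord_rotation b hB
  have comm : ∀ (π : Fin 4 → Fin 4) (ε : Fin 4 → ℝ), (∀ a, π (partner a) = partner (π a) ∧
      rotSign (partner a) * ε (partner a) = rotSign (partner (π a)) * ε a) →
      ∀ Y, B (signedPerm b π ε Y) = signedPerm b π ε (B Y) := by
    intro π ε hπ Y
    suffices E : B ∘ₗ signedPerm b π ε = signedPerm b π ε ∘ₗ B from congrArg (fun f => f Y) E
    refine b.ext fun ⟨j, a⟩ => ?_
    obtain ⟨h1, h2⟩ := hπ a
    simp only [LinearMap.comp_apply, signedPerm_basis, hB, map_smul, smul_smul, h1]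
    congr 1
    linear_combination -μ j * h2
  refine ⟨_, _, _, _, b (0, 0), B, isHyperHermitian_signedPerm b, ?_, ?_, ?_, ?_, ?_, ?_, ?_⟩
  · simp [basisMetric_basis]
  · simp [hB, hμ]
  · intro Y Z
    suffices E : (basisMetric b).compl₁₂ B LinearMap.id =
        -(basisMetric b).compl₁₂ LinearMap.id B from congrArg (fun f => f Y Z) E
    refine LinearMap.BilinForm.ext_basis b fun ⟨j, a⟩ ⟨j', a'⟩ => ?_
    simp only [LinearMap.neg_apply, LinearMap.compl₁₂_apply, LinearMap.id_apply, hB, map_smul,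
      LinearMap.smul_apply, basisMetric_basis, Prod.mk.injEq]
    by_cases hj : j = j'
    · subst hj
      fin_cases a <;> fin_cases a' <;> simp [partner, rotSign]
    · simp [hj]
  iterate 3
    apply comm
    intro a
    fin_cases a <;> simp [partner, rotSign]
  · intro Y Z
    rw [basisMetric_left]
    apply b.ext_elem
    intro p
    have e := congrArg (fun f => f Y Z) (hb p)
    simp only [d₁_apply, LinearMap.add_apply, LinearMap.smul_apply, wedge_apply, smul_eq_mul] at e
    have e1 := hBc p Y
    have e2 := hBc p Z
    simp only [map_add, map_sub, map_smul, Finsupp.add_apply, Finsupp.sub_apply, Finsupp.smul_apply,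
      ← Module.Basis.coord_apply, e1, e2, smul_eq_mul]
    linear_combination -e

/-- Only the basis vector normal to the ideal is multiplied by `t`. Since `μ 0 = 0`, no rotation
mixes it with the rest of its line. -/
theorem scale (hμ : μ 0 = 0) (H : HasQuaternionicForm L r c μ) {t : ℝ} (ht : t ≠ 0) :
    HasQuaternionicForm L r (t * c) (t • μ) := by
  obtain ⟨b, hb⟩ := H
  let w : Fin (r + 1) × Fin 4 → ℝˣ := fun p => if p = (0, 0) then Units.mk0 t ht else 1
  refine ⟨b.unitsSMul w, fun p => ?_⟩
  have h0 : (b.unitsSMul w).coord (0, 0) = t⁻¹ • b.coord (0, 0) := by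
    rw [Module.Basis.coord_unitsSMul]; simp [w, Units.smul_def]
  have h1 : ∀ q, q ≠ (0, 0) → (b.unitsSMul w).coord q = b.coord q := fun q hq => by
    rw [Module.Basis.coord_unitsSMul]; simp [w, hq]
  by_cases hp : p.1 = 0
  · obtain ⟨j, a⟩ := p
    obtain rfl : j = 0 := hp
    ext Y Z
    have e := congrArg (fun f => f Y Z) (hb (0, a))
    simp only [d₁_apply, LinearMap.add_apply, LinearMap.smul_apply, wedge_apply, smul_eq_mul, hμ] at e
    simp only [d₁_apply, LinearMap.add_apply, LinearMap.smul_apply, wedge_apply, smul_eq_mul, hμ,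
      h0, Pi.smul_apply]
    by_cases ha : a = 0
    · subst ha
      rw [h0]
      simp only [LinearMap.smul_apply, smul_eq_mul]
      linear_combination t⁻¹ * e
    · rw [h1 _ (by simpa using ha)]
      field_simp
      linear_combination e
  · have h2 : p ≠ (0, 0) := fun H => hp (by rw [H])
    have h3 : (p.1, partner p.2) ≠ (0, 0) := fun H => hp (Prod.mk.inj H).1
    ext Y Z
    have e := congrArg (fun f => f Y Z) (hb p)
    simp only [d₁_apply, LinearMap.add_apply, LinearMap.smul_apply, wedge_apply, smul_eq_mul] at e
    simp only [d₁_apply, LinearMap.add_apply, LinearMap.smul_apply, wedge_apply, smul_eq_mul,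
      h0, h1 p h2, h1 _ h3, Pi.smul_apply]
    field_simp
    linear_combination e

theorem permute (H : HasQuaternionicForm L r c μ) (e : Equiv.Perm (Fin (r + 1))) (he : e 0 = 0) :
    HasQuaternionicForm L r c (μ ∘ e) := by
  obtain ⟨b, hb⟩ := H
  refine ⟨b.reindex (e.symm.prodCongr (Equiv.refl _)), fun p => ?_⟩
  have hc : ∀ q, (b.reindex (e.symm.prodCongr (Equiv.refl _))).coord q = b.coord (e q.1, q.2) :=
    fun q => by
      ext Y
      rw [Module.Basis.coord_apply, Module.Basis.repr_reindex_apply]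
      rfl
  simp only [hc, hb, he, Function.comp_apply]

end HasQuaternionicForm

/-- The common 1-form is 0 here, and `l = -2c g(X, ·)` then gives `c = 0`. -/
theorem admitsHyperkahler_iff (hL : IsAlmostAbelian L) (hr : Module.finrank ℝ L = 4 * (r + 1)) :
    AdmitsHyperkahler L ↔ ∃ μ : Fin (r + 1) → ℝ, μ 0 = 0 ∧ HasQuaternionicForm L r 0 μ := by
  have : FiniteDimensional ℝ L := Module.finite_of_finrank_pos (by omega)
  constructor
  · rintro ⟨I, J, K, g, h⟩
    have hH := h.hypercomplex.isHyperHermitian h.fst.hermitian h.snd.hermitian h.trd.hermitian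
    obtain ⟨X, c, B, hB, hl⟩ := hH.exists_normalBracket hL (l := 0)
      (fun Y Z W => by rw [h.fst.closed]; simp [wedge₁₂])
      (fun Y Z W => by rw [h.snd.closed]; simp [wedge₁₂])
      (fun Y Z W => by rw [h.trd.closed]; simp [wedge₁₂])
    have hc := congrArg (fun f => f X) hl
    simp [hB.unit] at hc
    subst hc
    exact hB.hasQuaternionicForm hH hr
  · rintro ⟨μ, hμ, H⟩
    obtain ⟨I, J, K, g, X, B, h, hB⟩ := H.exists_normalBracket hμ
    exact ⟨I, J, K, g, hB.isHyperkahler h⟩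

/-- If `c` were 0 the given structure would be hyperkähler; otherwise rescaling by `c⁻¹` normalises
it to 1. -/
theorem admitsNonHyperkahlerLCHK_iff (hL : IsAlmostAbelian L)
    (hr : Module.finrank ℝ L = 4 * (r + 1)) : AdmitsNonHyperkahlerLCHK L ↔
      ∃ μ : Fin (r + 1) → ℝ, μ 0 = 0 ∧ HasQuaternionicForm L r 1 μ := by
  have : FiniteDimensional ℝ L := Module.finite_of_finrank_pos (by omega)
  constructor
  · rintro ⟨I, J, K, g, ⟨h, θ, h1, h2, h3⟩, hn⟩
    have hH := h.isHyperHermitian h1.hermitian h2.hermitian h3.hermitian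
    obtain ⟨X, c, B, hB, -⟩ := hH.exists_normalBracket hL
      (l := ((Module.finrank ℝ L : ℝ) / 2 - 1)⁻¹ • θ)
      (fun Y Z W => by rw [h1.lee]; simp only [wedge₁₂, LinearMap.smul_apply, smul_eq_mul]; ring)
      (fun Y Z W => by rw [h2.lee]; simp only [wedge₁₂, LinearMap.smul_apply, smul_eq_mul]; ring)
      (fun Y Z W => by rw [h3.lee]; simp only [wedge₁₂, LinearMap.smul_apply, smul_eq_mul]; ring)
    have hc : c ≠ 0 := by
      rintro rfl
      exact hn (hB.isHyperkahler hH)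
    obtain ⟨μ, hμ, H⟩ := hB.hasQuaternionicForm hH hr
    refine ⟨c⁻¹ • μ, by simp [hμ], ?_⟩
    simpa [hc] using H.scale hμ (inv_ne_zero hc)
  · rintro ⟨μ, hμ, H⟩
    obtain ⟨I, J, K, g, X, B, h, hB⟩ := H.exists_normalBracket hμ
    refine ⟨I, J, K, g, hB.isLCHK h ?_, hB.not_isHyperkahler h one_ne_zero⟩
    -- The normalising constant is `2 * r + 1`, which is positive.
    rw [hr]
    push_cast
    have : (0 : ℝ) ≤ r := Nat.cast_nonneg r
    linarith

/-- The assumption `f i i = 0` absorbs the terms in which the normal coordinate is wedged with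
itself. -/
theorem hasQuaternionicForm_iff {n : ℕ} (e : Fin (r + 1) × Fin 4 ≃ Fin n)
    {eqs : (Fin n → Fin n → LinearMap.BilinForm ℝ L) → Fin n → LinearMap.BilinForm ℝ L}
    (h : ∀ f : Fin n → Fin n → LinearMap.BilinForm ℝ L, (∀ i, f i i = 0) → ∀ j a,
      eqs f (e (j, a)) = c • f (e (j, a)) (e (0, 0)) +
        (μ j * rotSign a) • f (e (j, partner a)) (e (0, 0))) :
    HasQuaternionicForm L r c μ ↔ HasStructureEquations L n eqs := by
  have hw : ∀ α : Module.Dual ℝ L, wedge α α = 0 := fun α => by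
    ext Y Z
    simp [wedge_apply, mul_comm]
  constructor
  · rintro ⟨b, hb⟩
    refine ⟨b.reindex e, fun i => ?_⟩
    obtain ⟨⟨j, a⟩, rfl⟩ := e.surjective i
    have hc : ∀ q, (b.reindex e).coord (e q) = b.coord q := fun q => by ext; simp
    rw [h _ fun i => hw _]
    simp only [hc, hb]
  · rintro ⟨b, hb⟩
    refine ⟨b.reindex e.symm, fun p => ?_⟩
    have hc : ∀ q, (b.reindex e.symm).coord q = b.coord (e q) := fun q => by ext; simp
    simp only [hc]
    rw [hb, h _ fun i => hw _]

end

/-! ### Translation into explicit structure equations -/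

/-- The coordinates of three quaternionic lines, those of the first line last. -/
noncomputable def hyperkahlerIndexTwelve : Fin 3 × Fin 4 ≃ Fin 12 :=
  Equiv.ofBijective (fun p => ![![11, 8, 9, 10], ![0, 1, 2, 3], ![4, 5, 6, 7]] p.1 p.2)
    ((Fintype.bijective_iff_injective_and_card _).2 ⟨by decide, by simp⟩)

/-- The coordinates of three quaternionic lines, the distinguished one last. -/
noncomputable def lchkIndexTwelve : Fin 3 × Fin 4 ≃ Fin 12 :=
  Equiv.ofBijective (fun p => ![![11, 0, 1, 2], ![3, 4, 5, 6], ![7, 8, 9, 10]] p.1 p.2)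
    ((Fintype.bijective_iff_injective_and_card _).2 ⟨by decide, by simp⟩)

/-- The coordinates of two quaternionic lines, those of the first line last. -/
noncomputable def hyperkahlerIndexEight : Fin 2 × Fin 4 ≃ Fin 8 :=
  Equiv.ofBijective (fun p => ![![7, 4, 5, 6], ![0, 1, 2, 3]] p.1 p.2)
    ((Fintype.bijective_iff_injective_and_card _).2 ⟨by decide, by simp⟩)

/-- The coordinates of two quaternionic lines, the distinguished one last. -/
noncomputable def lchkIndexEight : Fin 2 × Fin 4 ≃ Fin 8 :=
  Equiv.ofBijective (fun p => ![![7, 0, 1, 2], ![3, 4, 5, 6]] p.1 p.2)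
    ((Fintype.bijective_iff_injective_and_card _).2 ⟨by decide, by simp⟩)

/-- The coordinates of one quaternionic line, the distinguished one last. -/
noncomputable def indexFour : Fin 1 × Fin 4 ≃ Fin 4 :=
  Equiv.ofBijective (fun p => ![![3, 0, 1, 2]] p.1 p.2)
    ((Fintype.bijective_iff_injective_and_card _).2 ⟨by decide, by simp⟩)

section

variable {L : Type*} [LieRing L] [LieAlgebra ℝ L]

theorem quaternionicForm_four_zero :
    HasQuaternionicForm L 0 0 ![0] ↔
      HasStructureEquations L 4 fun _ => ![0, 0, 0, 0] := by
  refine hasQuaternionicForm_iff indexFour fun f hf j a => ?_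
  fin_cases j; fin_cases a <;> simp [indexFour, partner, rotSign, hf]

theorem quaternionicForm_four_one :
    HasQuaternionicForm L 0 1 ![0] ↔
      HasStructureEquations L 4 fun f => ![f 0 3, f 1 3, f 2 3, 0] := by
  refine hasQuaternionicForm_iff indexFour fun f hf j a => ?_
  fin_cases j; fin_cases a <;> simp [indexFour, partner, rotSign, hf]

theorem quaternionicForm_eight_zero :
    HasQuaternionicForm L 1 0 ![0, 0] ↔
      HasStructureEquations L 8 fun _ => ![0, 0, 0, 0, 0, 0, 0, 0] := by
  refine hasQuaternionicForm_iff hyperkahlerIndexEight fun f hf j a => ?_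
  fin_cases j <;> fin_cases a <;> simp [hyperkahlerIndexEight, partner, rotSign, hf]

theorem quaternionicForm_eight_rotation :
    HasQuaternionicForm L 1 0 ![0, 1] ↔
      HasStructureEquations L 8 fun f => ![f 1 7, -f 0 7, f 3 7, -f 2 7, 0, 0, 0, 0] := by
  refine hasQuaternionicForm_iff hyperkahlerIndexEight fun f hf j a => ?_
  fin_cases j <;> fin_cases a <;> simp [hyperkahlerIndexEight, partner, rotSign, hf] <;> module

theorem quaternionicForm_eight_one :
    HasQuaternionicForm L 1 1 ![0, 0] ↔
      HasStructureEquations L 8 fun f =>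
        ![f 0 7, f 1 7, f 2 7, f 3 7, f 4 7, f 5 7, f 6 7, 0] := by
  refine hasQuaternionicForm_iff lchkIndexEight fun f hf j a => ?_
  fin_cases j <;> fin_cases a <;> simp [lchkIndexEight, partner, rotSign, hf]

theorem quaternionicForm_eight_one_rotation (p : ℝ) :
    HasQuaternionicForm L 1 1 ![0, p] ↔
      HasStructureEquations L 8 fun f =>
        ![f 0 7, f 1 7, f 2 7,
          f 3 7 + p • f 4 7, -(p • f 3 7) + f 4 7,
          f 5 7 + p • f 6 7, -(p • f 5 7) + f 6 7, 0] := by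
  refine hasQuaternionicForm_iff lchkIndexEight fun f hf j a => ?_
  fin_cases j <;> fin_cases a <;> simp [lchkIndexEight, partner, rotSign, hf] <;> module

theorem quaternionicForm_twelve_zero :
    HasQuaternionicForm L 2 0 ![0, 0, 0] ↔
      HasStructureEquations L 12 fun _ => ![0, 0, 0, 0, 0, 0, 0, 0, 0, 0, 0, 0] := by
  refine hasQuaternionicForm_iff hyperkahlerIndexTwelve fun f hf j a => ?_
  fin_cases j <;> fin_cases a <;> simp [hyperkahlerIndexTwelve, partner, rotSign, hf]

theorem quaternionicForm_twelve_rotation :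
    HasQuaternionicForm L 2 0 ![0, 1, 0] ↔
      HasStructureEquations L 12 fun f =>
        ![f 1 11, -f 0 11, f 3 11, -f 2 11, 0, 0, 0, 0, 0, 0, 0, 0] := by
  refine hasQuaternionicForm_iff hyperkahlerIndexTwelve fun f hf j a => ?_
  fin_cases j <;> fin_cases a <;> simp [hyperkahlerIndexTwelve, partner, rotSign, hf] <;> module

theorem quaternionicForm_twelve_two_rotations (p : ℝ) :
    HasQuaternionicForm L 2 0 ![0, 1, p] ↔
      HasStructureEquations L 12 fun f =>
        ![f 1 11, -f 0 11, f 3 11, -f 2 11,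
          p • f 5 11, -(p • f 4 11), p • f 7 11, -(p • f 6 11), 0, 0, 0, 0] := by
  refine hasQuaternionicForm_iff hyperkahlerIndexTwelve fun f hf j a => ?_
  fin_cases j <;> fin_cases a <;> simp [hyperkahlerIndexTwelve, partner, rotSign, hf] <;> module

theorem quaternionicForm_twelve_one :
    HasQuaternionicForm L 2 1 ![0, 0, 0] ↔
      HasStructureEquations L 12 fun f =>
        ![f 0 11, f 1 11, f 2 11, f 3 11, f 4 11, f 5 11, f 6 11, f 7 11, f 8 11, f 9 11,
          f 10 11, 0] := by
  refine hasQuaternionicForm_iff lchkIndexTwelve fun f hf j a => ?_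
  fin_cases j <;> fin_cases a <;> simp [lchkIndexTwelve, partner, rotSign, hf]

theorem quaternionicForm_twelve_one_rotation (p : ℝ) :
    HasQuaternionicForm L 2 1 ![0, 0, p] ↔
      HasStructureEquations L 12 fun f =>
        ![f 0 11, f 1 11, f 2 11, f 3 11, f 4 11, f 5 11, f 6 11,
          f 7 11 + p • f 8 11, -(p • f 7 11) + f 8 11,
          f 9 11 + p • f 10 11, -(p • f 9 11) + f 10 11, 0] := by
  refine hasQuaternionicForm_iff lchkIndexTwelve fun f hf j a => ?_
  fin_cases j <;> fin_cases a <;> simp [lchkIndexTwelve, partner, rotSign, hf] <;> module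

theorem quaternionicForm_twelve_one_two_rotations (p q : ℝ) :
    HasQuaternionicForm L 2 1 ![0, p, q] ↔
      HasStructureEquations L 12 fun f =>
        ![f 0 11, f 1 11, f 2 11,
          f 3 11 + p • f 4 11, -(p • f 3 11) + f 4 11,
          f 5 11 + p • f 6 11, -(p • f 5 11) + f 6 11,
          f 7 11 + q • f 8 11, -(q • f 7 11) + f 8 11,
          f 9 11 + q • f 10 11, -(q • f 9 11) + f 10 11, 0] := by
  refine hasQuaternionicForm_iff lchkIndexTwelve fun f hf j a => ?_
  fin_cases j <;> fin_cases a <;> simp [lchkIndexTwelve, partner, rotSign, hf] <;> module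

theorem HasQuaternionicForm.swap {c p q : ℝ} (H : HasQuaternionicForm L 2 c ![0, p, q]) :
    HasQuaternionicForm L 2 c ![0, q, p] := by
  have e : (![0, p, q] ∘ Equiv.swap (1 : Fin 3) 2 : Fin 3 → ℝ) = ![0, q, p] := by
    ext i
    fin_cases i
    · rfl
    · simp
    · simp
  rw [← e]
  exact H.permute (Equiv.swap 1 2) (by decide)

end

/-! ### Case analysis on the vanishing of the rotation speeds -/

/-- Almost abelian Lie algebras of dimension `4`, `8` and `12` admitting hyperkähler structures,
respectively non-hyperkähler locally conformally hyperkähler structures. -/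
theorem proposition5p2 (L : Type*) [LieRing L] [LieAlgebra ℝ L] (hL : IsAlmostAbelian L) :
    (Module.finrank ℝ L = 4 →
      (AdmitsHyperkahler L ↔
        HasStructureEquations L 4 fun _ => ![0, 0, 0, 0]) ∧
      (AdmitsNonHyperkahlerLCHK L ↔
        HasStructureEquations L 4 fun f => ![f 0 3, f 1 3, f 2 3, 0])) ∧
    (Module.finrank ℝ L = 8 →
      (AdmitsHyperkahler L ↔
        (HasStructureEquations L 8 fun _ => ![0, 0, 0, 0, 0, 0, 0, 0]) ∨
        (HasStructureEquations L 8 fun f => ![f 1 7, -f 0 7, f 3 7, -f 2 7, 0, 0, 0, 0])) ∧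
      (AdmitsNonHyperkahlerLCHK L ↔
        (HasStructureEquations L 8 fun f =>
          ![f 0 7, f 1 7, f 2 7, f 3 7, f 4 7, f 5 7, f 6 7, 0]) ∨
        (∃ p : ℝ, p ≠ 0 ∧ HasStructureEquations L 8 fun f =>
          ![f 0 7, f 1 7, f 2 7,
            f 3 7 + p • f 4 7, -(p • f 3 7) + f 4 7,
            f 5 7 + p • f 6 7, -(p • f 5 7) + f 6 7, 0]))) ∧
    (Module.finrank ℝ L = 12 →
      (AdmitsHyperkahler L ↔
        (HasStructureEquations L 12 fun _ => ![0, 0, 0, 0, 0, 0, 0, 0, 0, 0, 0, 0]) ∨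
        (HasStructureEquations L 12 fun f =>
          ![f 1 11, -f 0 11, f 3 11, -f 2 11, 0, 0, 0, 0, 0, 0, 0, 0]) ∨
        (∃ p : ℝ, p ≠ 0 ∧ HasStructureEquations L 12 fun f =>
          ![f 1 11, -f 0 11, f 3 11, -f 2 11,
            p • f 5 11, -(p • f 4 11), p • f 7 11, -(p • f 6 11), 0, 0, 0, 0])) ∧
      (AdmitsNonHyperkahlerLCHK L ↔
        (HasStructureEquations L 12 fun f =>
          ![f 0 11, f 1 11, f 2 11, f 3 11, f 4 11, f 5 11, f 6 11, f 7 11, f 8 11, f 9 11,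
            f 10 11, 0]) ∨
        (∃ p : ℝ, p ≠ 0 ∧ HasStructureEquations L 12 fun f =>
          ![f 0 11, f 1 11, f 2 11, f 3 11, f 4 11, f 5 11, f 6 11,
            f 7 11 + p • f 8 11, -(p • f 7 11) + f 8 11,
            f 9 11 + p • f 10 11, -(p • f 9 11) + f 10 11, 0]) ∨
        (∃ p q : ℝ, p * q ≠ 0 ∧ HasStructureEquations L 12 fun f =>
          ![f 0 11, f 1 11, f 2 11,
            f 3 11 + p • f 4 11, -(p • f 3 11) + f 4 11,
            f 5 11 + p • f 6 11, -(p • f 5 11) + f 6 11,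
            f 7 11 + q • f 8 11, -(q • f 7 11) + f 8 11,
            f 9 11 + q • f 10 11, -(q • f 9 11) + f 10 11, 0]))) := by
  refine ⟨fun hd => ?_, fun hd => ?_, fun hd => ?_⟩
  · rw [admitsHyperkahler_iff (r := 0) hL hd, admitsNonHyperkahlerLCHK_iff (r := 0) hL hd,
      ← quaternionicForm_four_zero, ← quaternionicForm_four_one]
    have key : ∀ μ : Fin 1 → ℝ, μ 0 = 0 → μ = ![0] := fun μ hμ => by
      ext i
      fin_cases i
      exact hμ
    refine ⟨⟨?_, fun H => ⟨_, rfl, H⟩⟩, ⟨?_, fun H => ⟨_, rfl, H⟩⟩⟩ <;>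
    · rintro ⟨μ, hμ, H⟩
      rwa [key μ hμ] at H
  · rw [admitsHyperkahler_iff (r := 1) hL hd, admitsNonHyperkahlerLCHK_iff (r := 1) hL hd]
    simp only [← quaternionicForm_eight_zero, ← quaternionicForm_eight_rotation,
      ← quaternionicForm_eight_one, ← quaternionicForm_eight_one_rotation]
    have key : ∀ μ : Fin 2 → ℝ, μ 0 = 0 → μ = ![0, μ 1] := fun μ hμ => by
      ext i
      fin_cases i
      · exact hμ
      · rfl
    constructor
    · constructor
      · rintro ⟨μ, hμ, H⟩
        by_cases hp : μ 1 = 0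
        · rw [key μ hμ, hp] at H
          exact Or.inl H
        -- With `c = 0` the scale of the normal is free and sets the speed to 1. In the LCHK case `c
        -- = 1` fixes it, so `p` remains a parameter.
        · have := H.scale hμ (inv_ne_zero hp)
          rw [key ((μ 1)⁻¹ • μ) (by simp [hμ])] at this
          right
          simpa [hp] using this
      · rintro (H | H) <;> exact ⟨_, rfl, H⟩
    · constructor
      · rintro ⟨μ, hμ, H⟩
        rw [key μ hμ] at H
        by_cases hp : μ 1 = 0
        · rw [hp] at H
          exact Or.inl H
        · exact Or.inr ⟨_, hp, H⟩
      · rintro (H | ⟨p, -, H⟩) <;> exact ⟨_, rfl, H⟩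
  · rw [admitsHyperkahler_iff (r := 2) hL hd, admitsNonHyperkahlerLCHK_iff (r := 2) hL hd]
    simp only [← quaternionicForm_twelve_zero, ← quaternionicForm_twelve_rotation,
      ← quaternionicForm_twelve_two_rotations, ← quaternionicForm_twelve_one,
      ← quaternionicForm_twelve_one_rotation, ← quaternionicForm_twelve_one_two_rotations]
    have key : ∀ μ : Fin 3 → ℝ, μ 0 = 0 → μ = ![0, μ 1, μ 2] := fun μ hμ => by
      ext i
      fin_cases i
      · exact hμ
      · rfl
      · rfl
    have scale : ∀ p q : ℝ, p ≠ 0 → HasQuaternionicForm L 2 0 ![0, p, q] →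
        HasQuaternionicForm L 2 0 ![0, 1, p⁻¹ * q] := fun p q hp H => by
      simpa [hp] using H.scale rfl (inv_ne_zero hp)
    constructor
    · constructor
      · rintro ⟨μ, hμ, H⟩
        rw [key μ hμ] at H
        by_cases hp : μ 1 = 0 <;> by_cases hq : μ 2 = 0
        · rw [hp, hq] at H
          exact Or.inl H
        -- If only the last line rotates, exchanging the two lines reduces to the case where the
        -- rotation is on the first of them.
        · have := scale _ _ hq H.swap
          rw [hp, mul_zero] at this
          exact Or.inr (Or.inl this)
        · have := scale _ _ hp H
          rw [hq, mul_zero] at this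
          exact Or.inr (Or.inl this)
        · exact Or.inr (Or.inr ⟨_, mul_ne_zero (inv_ne_zero hp) hq, scale _ _ hp H⟩)
      · rintro (H | H | ⟨p, -, H⟩) <;> exact ⟨_, rfl, H⟩
    · constructor
      · rintro ⟨μ, hμ, H⟩
        rw [key μ hμ] at H
        by_cases hp : μ 1 = 0 <;> by_cases hq : μ 2 = 0
        · rw [hp, hq] at H
          exact Or.inl H
        · rw [hp] at H
          exact Or.inr (Or.inl ⟨_, hq, H⟩)
        · rw [hq] at H
          exact Or.inr (Or.inl ⟨_, hp, H.swap⟩)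
        · exact Or.inr (Or.inr ⟨_, _, mul_ne_zero hp hq, H⟩)
      · rintro (H | ⟨p, -, H⟩ | ⟨p, q, -, H⟩) <;> exact ⟨_, rfl, H⟩
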